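/- Let $A$ be a commutative ring with unit group $A^\times$. Let $\Gamma(A)$ be the graph whose vertices are the classes $[u]$ of unimodular rows $u=(u_1,u_2)\in A^2$ (that is, $u_1A+u_2A=A$) under multiplication by units of $A$, in which two distinct vertices $[u],[v]$ are joined by an edge if the matrix with rows $u$ and $v$ lies in $\mathrm{GL}_2(A)$. Let $Y(A)$ be the clique complex of $\Gamma(A)$, i.e. the simplicial complex whose $n$-simplices are the sets of $n+1$ distinct, pairwise adjacent vertices of $\Gamma(A)$, and let $|Y(A)|$ be its geometric realization with the weak topology. Let $C(A)$ be the group with generators $\epsilon(a)$, $a\in A$, subject to the following relations, where $h(u):=\epsilon(-u)\,\epsilon(-u^{-1})\,\epsilon(-u)$ for $u\in A^\times$: 1. $h(u)h(v)=h(uv)$ for all $u,v\in A^\times$; 2. $\epsilon(a)\,\epsilon(0)\,\epsilon(b)=h(-1)\,\epsilon(a+b)$ for all $a,b\in A$; 3. $h(u)\,\epsilon(a)\,h(u)=\epsilon(u^2a)$ for all $u\in A^\times$, $a\in A$. Let $\psi:C(A)\to \mathrm{SL}_2(A)$ be the homomorphism with $\psi(\epsilon(a))=E(a):=\begin{pmatrix}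 a&1\\-1&0\end{pmatrix}$ for all $a\in A$. The ring $A$ is called universal for $\mathrm{GE}_2$ if $\psi$ is injective. Then $A$ is universal for $\mathrm{GE}_2$ if and only if every path component of $|Y(A)|$ is simply connected. -/

import Mathlib

/-! ### The clique complex of a graph and geometric realization -/

/-- The clique complex of a simple graph: its simplices are the nonempty finite cliques. -/
def SimpleGraph.cliqueComplex {V : Type*} (G : SimpleGraph V) : AbstractSimplicialComplex V where
  faces := {s | s.Nonempty ∧ G.IsClique (s : Set V)}
  isRelLowerSet_faces := fun _ hs =>
    ⟨hs.1, fun _ hts ht => ⟨ht, hs.2.subset (Finset.coe_subset.mpr hts)⟩⟩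
  singleton_mem := fun v => ⟨Finset.singleton_nonempty v, by simp⟩

/-- The points of the geometric realization `|K|` in barycentric coordinates: finitely supported
functions on the vertices with non-negative values of sum `1` whose support is a simplex of `K`. -/
def AbstractSimplicialComplex.Realization {V : Type*} (K : AbstractSimplicialComplex V) : Type _ :=
  {f : V →₀ ℝ // (∀ v, 0 ≤ f v) ∧ (f.sum fun _ t => t) = 1 ∧ f.support ∈ K.faces}

namespace AbstractSimplicialComplex

/-- The inclusion into `|K|` of the closed standard simplex spanned by a simplex `s` of `K`
(barycentric coordinates are extended by zero). -/
noncomputable def Realization.ofSimplex {V : Type*} (K : AbstractSimplicialComplex V)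
    (s : Finset V) (hs : s ∈ K.faces) (x : stdSimplex ℝ s) : K.Realization :=
  ⟨(Finsupp.equivFunOnFinite.symm (x : s → ℝ)).embDomain (Function.Embedding.subtype (· ∈ s)), by
    have hsum : ((Finsupp.equivFunOnFinite.symm (x : s → ℝ)).embDomain
        (Function.Embedding.subtype (· ∈ s))).sum (fun _ t => t) = 1 := by
      rw [Finsupp.sum_embDomain, Finsupp.sum_fintype _ _ (fun _ => rfl)]
      exact x.2.2
    refine ⟨fun v => ?_, hsum, ?_⟩
    · by_cases hv : v ∈ Set.range (Function.Embedding.subtype (· ∈ s))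
      · obtain ⟨w, rfl⟩ := hv
        rw [Finsupp.embDomain_apply_self]
        exact x.2.1 w
      · rw [Finsupp.embDomain_of_notMem_range _ _ _ hv]
    · refine (K.isRelLowerSet_faces hs).2 (fun v hv => ?_) ?_
      · rw [Finsupp.support_embDomain, Finset.mem_map] at hv
        obtain ⟨w, _, rfl⟩ := hv
        exact w.2
      · rw [Finset.nonempty_iff_ne_empty]
        intro h
        rw [Finsupp.sum, h, Finset.sum_empty] at hsum
        exact zero_ne_one hsum⟩

/-- The weak topology on `|K|`: a set is open if and only if its preimage in every closed simplex
(with the Euclidean topology) is open. -/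
noncomputable instance Realization.instTopologicalSpace {V : Type*} (K : AbstractSimplicialComplex V) :
    TopologicalSpace K.Realization :=
  ⨆ s : {s : Finset V // s ∈ K.faces},
    TopologicalSpace.coinduced (Realization.ofSimplex K s.1 s.2) inferInstance

end AbstractSimplicialComplex

namespace GE2

/-! ### The graph `Γ(A)` and the complex `Y(A)` -/

/-- Unimodular rows `(a, b)` of length two: those with `r * a + s * b = 1` for some `r`, `s`. -/
def UnimodularRow (A : Type*) [CommRing A] : Type _ :=
  {u : A × A // IsCoprime u.1 u.2}

/-- Two unimodular rows are equivalent if they differ by multiplication by a unit. -/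
def rowSetoid (A : Type*) [CommRing A] : Setoid (UnimodularRow A) where
  r u v := ∃ c : Aˣ, v.1 = ((c : A) * u.1.1, (c : A) * u.1.2)
  iseqv :=
    { refl := fun u => ⟨1, by simp⟩
      symm := by
        rintro u v ⟨c, h⟩
        refine ⟨c⁻¹, ?_⟩
        rw [h]
        simp
      trans := by
        rintro u v w ⟨c, h⟩ ⟨d, h'⟩
        refine ⟨d * c, ?_⟩
        rw [h', h]
        simp [mul_assoc] }

/-- The vertices of `Γ(A)`: unimodular rows of length two up to multiplication by units. -/
def Vertex (A : Type*) [CommRing A] : Type _ :=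
  Quotient (rowSetoid A)

/-- The graph `Γ(A)`: two distinct classes `[u]`, `[v]` are adjacent if the matrix with rows
`u`, `v` is invertible. -/
def graph (A : Type*) [CommRing A] : SimpleGraph (Vertex A) where
  Adj x y := x ≠ y ∧ ∃ u v : UnimodularRow A,
    Quotient.mk (rowSetoid A) u = x ∧ Quotient.mk (rowSetoid A) v = y ∧
      IsUnit (!![u.1.1, u.1.2; v.1.1, v.1.2] : Matrix (Fin 2) (Fin 2) A).det
  symm := ⟨by
    rintro x y ⟨hne, u, v, hu, hv, h⟩
    refine ⟨hne.symm, v, u, hv, hu, ?_⟩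
    rw [Matrix.det_fin_two_of] at h ⊢
    have e : v.1.1 * u.1.2 - v.1.2 * u.1.1 = -(u.1.1 * v.1.2 - u.1.2 * v.1.1) := by ring
    rw [e]
    exact h.neg⟩
  loopless := ⟨fun _ h => h.1 rfl⟩

/-- The complex `Y(A)`: the clique complex of `Γ(A)`. -/
def Y (A : Type*) [CommRing A] : AbstractSimplicialComplex (Vertex A) :=
  (graph A).cliqueComplex

/-! ### The group `C(A)` and rings which are universal for `GE₂` -/

/-- The matrix `E(a)` in `SL₂(A)`. -/
def E {A : Type*} [CommRing A] (a : A) : Matrix.SpecialLinearGroup (Fin 2) A :=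
  ⟨!![a, 1; -1, 0], by simp [Matrix.det_fin_two_of]⟩

theorem coe_E {A : Type*} [CommRing A] (a : A) :
    (E a : Matrix (Fin 2) (Fin 2) A) = !![a, 1; -1, 0] :=
  rfl

/-- The word `ε(-u) ε(-u⁻¹) ε(-u)` in the free group on the symbols `ε(a)`, `a ∈ A`. -/
def hWord {A : Type*} [CommRing A] (u : Aˣ) : FreeGroup A :=
  FreeGroup.of (-(u : A)) * FreeGroup.of (-((u⁻¹ : Aˣ) : A)) * FreeGroup.of (-(u : A))

/-- The three families of defining relators of `C(A)`. -/
def relators (A : Type*) [CommRing A] : Set (FreeGroup A) :=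
  {w | ∃ u v : Aˣ, w = hWord u * hWord v * (hWord (u * v))⁻¹} ∪
  {w | ∃ a b : A, w = FreeGroup.of a * FreeGroup.of 0 * FreeGroup.of b *
    (hWord (-1 : Aˣ) * FreeGroup.of (a + b))⁻¹} ∪
  {w | ∃ (u : Aˣ) (a : A), w = hWord u * FreeGroup.of a * hWord u *
    (FreeGroup.of ((u : A) ^ 2 * a))⁻¹}

/-- The group `C(A)` with generators `ε(a)`, `a ∈ A`, and relations `h(u) h(v) = h(u v)`,
`ε(a) ε(0) ε(b) = h(-1) ε(a + b)` and `h(u) ε(a) h(u) = ε(u² a)`. -/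
abbrev C (A : Type*) [CommRing A] : Type _ :=
  PresentedGroup (relators A)

theorem lift_hWord {A : Type*} [CommRing A] (u : Aˣ) :
    ((FreeGroup.lift (E : A → Matrix.SpecialLinearGroup (Fin 2) A) (hWord u) :
      Matrix.SpecialLinearGroup (Fin 2) A) : Matrix (Fin 2) (Fin 2) A) =
        !![(u : A), 0; 0, ((u⁻¹ : Aˣ) : A)] := by
  simp only [hWord, map_mul, FreeGroup.lift_apply_of, Matrix.SpecialLinearGroup.coe_mul, coe_E]
  simp

theorem lift_relators {A : Type*} [CommRing A] :
    ∀ w ∈ relators A,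
      FreeGroup.lift (E : A → Matrix.SpecialLinearGroup (Fin 2) A) w = 1 := by
  rintro w ((⟨u, v, rfl⟩ | ⟨a, b, rfl⟩) | ⟨u, a, rfl⟩)
  · rw [map_mul, map_inv, mul_inv_eq_one]
    apply Subtype.ext
    rw [map_mul, Matrix.SpecialLinearGroup.coe_mul, lift_hWord, lift_hWord, lift_hWord]
    simp [mul_comm]
  · rw [map_mul, map_inv, mul_inv_eq_one]
    apply Subtype.ext
    rw [map_mul (FreeGroup.lift E) (hWord (-1)), Matrix.SpecialLinearGroup.coe_mul, lift_hWord]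
    simp only [map_mul, FreeGroup.lift_apply_of, Matrix.SpecialLinearGroup.coe_mul, coe_E]
    simp [add_comm]
  · rw [map_mul, map_inv, mul_inv_eq_one]
    apply Subtype.ext
    rw [map_mul, map_mul, Matrix.SpecialLinearGroup.coe_mul, Matrix.SpecialLinearGroup.coe_mul,
      lift_hWord]
    simp [E]
    ring

/-- The homomorphism `ψ : C(A) → SL₂(A)` sending `ε(a)` to `E(a)`. -/
def psi (A : Type*) [CommRing A] : C A →* Matrix.SpecialLinearGroup (Fin 2) A :=
  PresentedGroup.toGroup (f := E) lift_relators

/-- `A` is universal for `GE₂` if the relations among the matrices `E(a)` are all consequences of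
the defining relations of `C(A)`, i.e. if `ψ` is injective. -/
def IsUniversalForGE2 (A : Type*) [CommRing A] : Prop :=
  Function.Injective (psi A)

end GE2

/-! Both conditions are compared with a third one: every group-valued 1-cocycle on `Y(A)` is a
coboundary.

Topology. The open stars of the vertices cover the realization, are contractible, and meet pairwise
in path-connected sets. A cocycle on this cover glues a covering with fibre the group, and simple
connectivity gives it a global section, which is a trivialization
(`isCoverCoboundary_of_simplyConnectedSpace`). Conversely, paths from a base point to the members of
the cover yield a cocycle with values in the fundamental group, and a trivialization of it kills
every loop (`homotopic_refl_of_isCoverCoboundary`).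

Algebra. Vertices are the cosets of the lower triangular subgroup of `SL₂(A)`, and the neighbours of
the vertex of `g` are the vertices of the `E(a) g`. Words in the `ε(a)` thus trace edge paths. The
defining relators trace loops that a cocycle sees as trivial, so `C(A)` acts on `SL₂(A) × G` by
transport (`lift_transport_relators`). If `ψ` is injective, this action lies over a free one and has
an equivariant section, which descends to the vertices as a trivialization.

Conversely, `ψ` has a section over the big cell, where the upper right entry is a unit, and this
section is multiplicative on triangles (`cellSection_mul`). It defines a `C(A)`-valued cocycle. A
trivialization yields `φ : SL₂(A) → C(A)` with `φ(ψ(d) g) = d φ(g)`, so `ψ(d) = 1` forces `d = 1`.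
-/

/-! ### Cocycles on good open covers -/

section GoodCovers

open CategoryTheory

universe u v w
variable {X : Type u} [TopologicalSpace X] {V : Type v}

/-- Group-valued `1`-cocycles on a cover. -/
def IsCoverCocycle (U : V → Set X) {G : Type w} [Group G] (k : V → V → G) : Prop :=
  ∀ ⦃x u v w⦄, x ∈ U u → x ∈ U v → x ∈ U w → k v w * k u v = k u w

/-- A cocycle on a cover is a coboundary if it is trivialized by a function on the index set. -/
def IsCoverCoboundary (U : V → Set X) {G : Type w} [Group G] (k : V → V → G) : Prop :=
  ∃ s : V → G, ∀ ⦃x u v⦄, x ∈ U u → x ∈ U v → s v = k u v * s u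

omit [TopologicalSpace X] in
theorem IsCoverCocycle.self {U : V → Set X} {G : Type w} [Group G] {k : V → V → G}
    (hk : IsCoverCocycle U k) {x : X} {v : V} (hx : x ∈ U v) : k v v = 1 := by
  simpa using hk hx hx hx

theorem Path.Homotopic.of_simplyConnectedSpace_pathComponent {x y : X}
    (h : SimplyConnectedSpace (pathComponent x)) (γ γ' : Path x y) : γ.Homotopic γ' := by
  -- The part of `δ` up to time `t` joins `x` to `δ t`.
  have hm : ∀ δ : Path x y, ∀ t, δ t ∈ pathComponent x := fun δ t =>
    ⟨(δ.truncateOfLE (t₀ := 0) (t₁ := (t : ℝ)) t.2.1).cast (by simp) (by simp)⟩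
  let lift : Path x y → Path (⟨x, mem_pathComponent_self x⟩ : pathComponent x)
      ⟨y, by simpa using hm γ 1⟩ := fun δ =>
    { toFun := fun t => ⟨δ t, hm δ t⟩
      continuous_toFun := by fun_prop
      source' := by simp
      target' := by simp }
  exact (SimplyConnectedSpace.paths_homotopic (lift γ) (lift γ')).map
    ⟨Subtype.val, continuous_subtype_val⟩

/-- The image of a null-homotopy is path connected and meets the component, hence stays in it. -/
theorem simplyConnectedSpace_pathComponent_of_homotopic_refl
    (h : ∀ (x : X) (γ : Path x x), γ.Homotopic (Path.refl x)) (x : X) :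
    SimplyConnectedSpace (pathComponent x) := by
  refine isSimplyConnected_iff_exists_homotopy_refl_forall_mem.2
    ⟨isPathConnected_pathComponent, fun y γ hγ => ?_⟩
  obtain ⟨F⟩ := h y γ
  refine ⟨F, fun t => ?_⟩
  have h1 : IsPathConnected (Set.range F) := by
    have : PathConnectedSpace (unitInterval × unitInterval) := by
      have : PathConnectedSpace unitInterval := isPathConnected_iff_pathConnectedSpace.1
        ((convex_Icc (0 : ℝ) 1).isPathConnected ⟨0, by simp⟩)
      infer_instance
    exact isPathConnected_range F.continuous
  have h2 : y ∈ pathComponent x := by simpa using hγ 0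
  have h3 : y ∈ Set.range F := ⟨(0, 0), by simp⟩
  have := h1.subset_pathComponent h3 (Set.mem_range_self t)
  rwa [pathComponent_congr h2] at this

/-- The fibre bundle with discrete fibre defined by a cocycle. -/
@[reducible]
noncomputable def IsCoverCocycle.core {U : V → Set X} {G : Type w} [Group G] [TopologicalSpace G]
    [DiscreteTopology G] {k : V → V → G} (hk : IsCoverCocycle U k) (hU : ∀ v, IsOpen (U v))
    (idx : X → V) (hidx : ∀ x, x ∈ U (idx x)) : FiberBundleCore V X G where
  baseSet := U
  isOpen_baseSet := hU
  indexAt := idx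
  mem_baseSet_at := hidx
  coordChange u v _ g := k u v * g
  coordChange_self v x hx g := by rw [hk.self hx, one_mul]
  continuousOn_coordChange u v :=
    ((continuous_of_discreteTopology (f := fun g : G => k u v * g)).comp
      continuous_snd).continuousOn
  coordChange_comp u v w x hx g := by rw [← mul_assoc, hk hx.1.1 hx.1.2 hx.2]

theorem isCoverCoboundary_of_simplyConnectedSpace {U : V → Set X} {G : Type w} [Group G]
    {k : V → V → G} (hk : IsCoverCocycle U k) (hU : ∀ v, IsOpen (U v)) (hcov : ∀ x, ∃ v, x ∈ U v)
    (hpc : ∀ v, IsPathConnected (U v))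
    (hsc : ∀ x : X, SimplyConnectedSpace (pathComponent x)) : IsCoverCoboundary U k := by
  classical
  let _ : TopologicalSpace G := ⊥
  have : DiscreteTopology G := ⟨rfl⟩
  choose idx hidx using hcov
  let Z := hk.core hU idx hidx
  have cov : IsCoveringMap Z.proj :=
    IsFiberBundle.isCoveringMap (F := G) fun x => ⟨Z.localTrivAt x, Z.mem_localTrivAt_baseSet x⟩
  -- One base point is chosen in each path component.
  let r : X → X := fun x => Quotient.out (s := pathSetoid X) (Quotient.mk (pathSetoid X) x)
  have hr : ∀ x, Joined (r x) x := fun x => Quotient.exact (s := pathSetoid X) (Quotient.out_eq _)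
  have hr' : ∀ x y, Joined x y → r x = r y := fun x y h => by
    have : (Quotient.mk (pathSetoid X) x) = Quotient.mk (pathSetoid X) y := Quotient.sound h
    simp only [r, this]
  let e0 : ∀ x, Z.proj ⁻¹' {x} := fun x => ⟨⟨x, (1 : G)⟩, rfl⟩
  -- The global section: the element `1` over the base point is carried along any path, the choice
  -- being irrelevant by simple connectivity.
  let σ : ∀ x, Z.proj ⁻¹' {x} := fun x => cov.monodromy (.mk (hr x).somePath) (e0 (r x))
  have hσ : ∀ {x y : X} (γ : Path x y), cov.monodromy (.mk γ) (σ x) = σ y := by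
    intro x y γ
    have key : ∀ (p : X) (_ : p = r x) (δ : Path p y),
        cov.monodromy (.mk γ) (σ x) = cov.monodromy (.mk δ) (e0 p) := by
      rintro p rfl δ
      rw [← cov.monodromy_trans_apply, ← Path.Homotopic.Quotient.mk_trans]
      rw [Path.Homotopic.Quotient.eq.2
        (Path.Homotopic.of_simplyConnectedSpace_pathComponent (hsc _) _ δ)]
    exact key _ (hr' x y ⟨γ⟩).symm _
  let coord : V → X → G := fun v x => (Z.localTriv v (σ x).1).2
  have hproj : ∀ x, Z.proj (σ x).1 = x := fun x => (σ x).2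
  -- In the chart over `U v`, a path lifts with constant fibre coordinate, and unique path lifting
  -- identifies this lift with the section.
  have hcoord : ∀ v x y, x ∈ U v → y ∈ U v → coord v x = coord v y := by
    intro v x y hx hy
    obtain ⟨γ, hγ⟩ := (hpc v).joinedIn x hx y hy
    let Γ : unitInterval → Z.TotalSpace := fun t =>
      (Z.localTriv v).toOpenPartialHomeomorph.symm (γ t, coord v x)
    have hmem : ∀ t, (γ t, coord v x) ∈ (Z.localTriv v).target := fun t => by
      rw [Bundle.Trivialization.mem_target]
      exact hγ t
    have hΓ : Continuous Γ := by
      rw [← continuousOn_univ]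
      exact (Z.localTriv v).toOpenPartialHomeomorph.continuousOn_symm.comp
        (by fun_prop) fun t _ => hmem t
    have h0 : Γ 0 = (σ x).1 := by
      have h1 : (σ x).1 ∈ (Z.localTriv v).source := by
        rw [Bundle.Trivialization.mem_source, hproj]
        exact hx
      have := (Z.localTriv v).symm_apply_mk_proj h1
      rw [hproj] at this
      simp only [Γ, γ.source]
      exact this
    have h1 : Γ 1 = (σ y).1 := by
      have h2 : Γ = cov.liftPath (γ : C(unitInterval, X)) (σ x).1 (by simp [hproj]) := by
        rw [cov.eq_liftPath_iff]
        refine ⟨hΓ, ?_, h0⟩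
        ext t
        exact (Z.localTriv v).proj_symm_apply (hmem t)
      rw [← hσ γ, h2]
      rfl
    have h2 := (Z.localTriv v).apply_symm_apply (hmem 1)
    calc coord v x = (Z.localTriv v (Γ 1)).2 := (congrArg Prod.snd h2).symm
      _ = coord v y := by rw [h1]
  refine ⟨fun v => coord v (hpc v).nonempty.some, fun x u v hu hv => ?_⟩
  simp only
  rw [hcoord v _ x (hpc v).nonempty.some_mem hv, hcoord u _ x (hpc u).nonempty.some_mem hu]
  have hi : x ∈ U (idx (σ x).1.proj) := by
    have := hidx x
    rwa [show (σ x).1.proj = x from hproj x]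
  have h : ∀ g : G, k (idx (σ x).1.proj) v * g = k u v * (k (idx (σ x).1.proj) u * g) :=
    fun g => by rw [← mul_assoc, hk hi hu hv]
  exact h _

/-- A family of path classes starting at `p` which is compatible with all paths contained in a
member of an open cover is compatible with all paths. -/
theorem FundamentalGroupoid.comp_eq_of_cover {U : V → Set X} (hU : ∀ v, IsOpen (U v))
    (hcov : ∀ x, ∃ v, x ∈ U v) (p : X)
    (β : ∀ x, Joined p x → ((⟨p⟩ : FundamentalGroupoid X) ⟶ ⟨x⟩))
    (hβ : ∀ (v : V) (x y : X) (γ : Path x y), (∀ t, γ t ∈ U v) → ∀ hx hy,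
      β x hx ≫ (Path.Homotopic.Quotient.mk γ : (⟨x⟩ : FundamentalGroupoid X) ⟶ ⟨y⟩) = β y hy)
    {x y : X} (γ : Path x y) (hx : Joined p x) (hy : Joined p y) :
    β x hx ≫ (Path.Homotopic.Quotient.mk γ : (⟨x⟩ : FundamentalGroupoid X) ⟶ ⟨y⟩) = β y hy := by
  obtain ⟨t, ht0, htm, ⟨n, hn⟩, ht⟩ := exists_monotone_Icc_subset_open_cover_unitInterval
    (c := fun v => γ ⁻¹' U v) (fun v => (hU v).preimage γ.continuous)
    (fun s _ => by simpa using hcov (γ s))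
  have hJ : ∀ s, Joined p (γ s) := fun s => by
    have h : Joined (γ 0) (γ s) := ⟨γ.subpath 0 s⟩
    rw [γ.source] at h
    exact hx.trans h
  -- Each piece of the subdivision lies in one member of the cover, so induction on the number of
  -- pieces applies.
  have key : ∀ m, β (γ 0) (hJ 0) ≫ (Path.Homotopic.Quotient.mk (γ.subpath 0 (t m)) :
      (⟨γ 0⟩ : FundamentalGroupoid X) ⟶ ⟨γ (t m)⟩) = β (γ (t m)) (hJ _) := by
    intro m
    induction m with
    | zero =>
      rw [ht0, Path.subpath_self]
      exact Category.comp_id _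
    | succ m ih =>
      obtain ⟨v, hv⟩ := ht m
      rw [← Path.Homotopic.Quotient.eq.2 ⟨Path.Homotopy.subpathTransSubpath γ 0 (t m) (t (m + 1))⟩,
        Path.Homotopic.Quotient.mk_trans]
      refine (Category.assoc _ _ _).symm.trans ?_
      rw [ih]
      refine hβ v _ _ _ (fun s => ?_) _ _
      have hs : γ.subpath (t m) (t (m + 1)) s ∈ Set.range (γ.subpath (t m) (t (m + 1))) :=
        Set.mem_range_self s
      rw [Path.range_subpath_of_le _ _ _ (htm (Nat.le_succ m))] at hs
      obtain ⟨r, hr, hr'⟩ := hs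
      rw [← hr']
      exact hv hr
  have h1 := key n
  rw [hn n le_rfl, Path.subpath_zero_one] at h1
  -- `γ 0 = x` and `γ 1 = y` are not definitional, so the endpoints are generalized.
  have hgen : ∀ (a b : X) (ha : a = x) (hb : b = y) (ja : Joined p a) (jb : Joined p b),
      β a ja ≫ (Path.Homotopic.Quotient.mk (γ.cast ha hb) :
        (⟨a⟩ : FundamentalGroupoid X) ⟶ ⟨b⟩) = β b jb →
      β x hx ≫ (Path.Homotopic.Quotient.mk γ : (⟨x⟩ : FundamentalGroupoid X) ⟶ ⟨y⟩) =
        β y hy := by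
    rintro a b rfl rfl ja jb h
    exact h
  exact hgen _ _ γ.source γ.target _ _ h1

/-- If all cocycles with values in the fundamental group are coboundaries, then the fundamental
group is trivial. -/
theorem homotopic_refl_of_isCoverCoboundary {U : V → Set X} (hU : ∀ v, IsOpen (U v))
    (hcov : ∀ x, ∃ v, x ∈ U v) (hsc : ∀ v, IsSimplyConnected (U v))
    (hpc : ∀ u v, (U u ∩ U v).Nonempty → IsPathConnected (U u ∩ U v)) (p : X)
    (h : ∀ k : V → V → FundamentalGroup X p, IsCoverCocycle U k → IsCoverCoboundary U k)
    (γ : Path p p) : γ.Homotopic (Path.refl p) := by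
  classical
  choose idx hidx using hcov
  let O : V → X := fun v => (hsc v).nonempty.some
  have hO : ∀ v, O v ∈ U v := fun v => (hsc v).nonempty.some_mem
  have hcls : ∀ v x y, x ∈ U v → y ∈ U v → ∃ c : (⟨x⟩ : FundamentalGroupoid X) ⟶ ⟨y⟩,
      ∀ γ : Path x y, (∀ t, γ t ∈ U v) →
        c = (Path.Homotopic.Quotient.mk γ : (⟨x⟩ : FundamentalGroupoid X) ⟶ ⟨y⟩) := by
    intro v x y hx hy
    obtain ⟨δ, hδ⟩ := (hsc v).isPathConnected.joinedIn x hx y hy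
    refine ⟨Path.Homotopic.Quotient.mk δ, fun γ hγ => Path.Homotopic.Quotient.eq.2 ?_⟩
    have := (hsc v).simplyConnectedSpace
    let lift : ∀ γ : Path x y, (∀ t, γ t ∈ U v) → Path (⟨x, hx⟩ : U v) ⟨y, hy⟩ := fun γ hγ =>
      { toFun := fun t => ⟨γ t, hγ t⟩
        continuous_toFun := by fun_prop
        source' := by simp
        target' := by simp }
    exact (SimplyConnectedSpace.paths_homotopic (lift δ hδ) (lift γ hγ)).map
      ⟨Subtype.val, continuous_subtype_val⟩
  choose c hc using hcls
  have hcomp : ∀ v x y z hx hy hz, c v x y hx hy ≫ c v y z hy hz = c v x z hx hz := by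
    intro v x y z hx hy hz
    obtain ⟨γ, hγ⟩ := (hsc v).isPathConnected.joinedIn x hx y hy
    obtain ⟨δ, hδ⟩ := (hsc v).isPathConnected.joinedIn y hy z hz
    rw [hc v x y hx hy γ hγ, hc v y z hy hz δ hδ, hc v x z hx hz (γ.trans δ) ?_]
    · rfl
    · intro t
      have ht : γ.trans δ t ∈ Set.range (γ.trans δ) := Set.mem_range_self t
      rw [Path.trans_range] at ht
      rcases ht with ⟨s, hs⟩ | ⟨s, hs⟩
      · rw [← hs]; exact hγ s
      · rw [← hs]; exact hδ s
  have hcself : ∀ v x hx, c v x x hx hx = 𝟙 _ := fun v x hx =>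
    hc v x x hx hx (Path.refl x) (fun _ => hx)
  have hcc : ∀ u v x y hxu hyu hxv hyv, c u x y hxu hyu = c v x y hxv hyv := by
    intro u v x y hxu hyu hxv hyv
    obtain ⟨γ, hγ⟩ := (hpc u v ⟨x, hxu, hxv⟩).joinedIn x ⟨hxu, hxv⟩ y ⟨hyu, hyv⟩
    rw [hc u x y hxu hyu γ fun t => (hγ t).1, hc v x y hxv hyv γ fun t => (hγ t).2]
  have hJ : ∀ v x, x ∈ U v → (Joined p x ↔ Joined p (O v)) := fun v x hx =>
    have hj := ((hsc v).isPathConnected.joinedIn x hx _ (hO v)).joined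
    ⟨fun h => h.trans hj, fun h => h.trans hj.symm⟩
  let α : ∀ v, Joined p (O v) → ((⟨p⟩ : FundamentalGroupoid X) ⟶ ⟨O v⟩) := fun v hv =>
    Path.Homotopic.Quotient.mk hv.somePath
  -- The loop runs from `p` to `O u`, through a point of the intersection to `O v`, and back to `p`.
  -- By `hcc` the intermediate point is irrelevant. The value `1` serves the components that do not
  -- contain `p`.
  let k : V → V → FundamentalGroup X p := fun u v =>
    if h : (U u ∩ U v).Nonempty ∧ Joined p (O u) then
      α u h.2 ≫ c u _ _ (hO u) h.1.some_mem.1 ≫ c v _ _ h.1.some_mem.2 (hO v) ≫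
        Groupoid.inv (α v ((hJ v _ h.1.some_mem.2).1 ((hJ u _ h.1.some_mem.1).2 h.2)))
    else 1
  have hk1 : ∀ u v x (hu : x ∈ U u) (hv : x ∈ U v) (hx : Joined p x),
      k u v = α u ((hJ u x hu).1 hx) ≫ c u _ _ (hO u) hu ≫ c v _ _ hv (hO v) ≫
        Groupoid.inv (α v ((hJ v x hv).1 hx)) := by
    intro u v x hu hv hx
    have hne : (U u ∩ U v).Nonempty := ⟨x, hu, hv⟩
    simp only [k, dif_pos (And.intro hne ((hJ u x hu).1 hx))]
    have e1 := hcomp u _ x _ (hO u) hu hne.some_mem.1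
    have e2 := hcomp v _ x _ hne.some_mem.2 hv (hO v)
    have e3 := hcomp v x _ x hv hne.some_mem.2 hv
    rw [hcself] at e3
    rw [← e1, ← e2, hcc u v x _ hu hne.some_mem.1 hv hne.some_mem.2]
    simp only [Category.assoc]
    rw [reassoc_of% e3]
  have hk2 : ∀ u v x, x ∈ U u → ¬ Joined p x → k u v = 1 := fun u v x hu hx =>
    dif_neg fun h => hx ((hJ u x hu).2 h.2)
  have hk : IsCoverCocycle U k := by
    intro x u v w hu hv hw
    by_cases hx : Joined p x
    · rw [hk1 u v x hu hv hx, hk1 v w x hv hw hx, hk1 u w x hu hw hx, End.mul_def]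
      have e := hcomp v x _ x hv (hO v) hv
      rw [hcself] at e
      simp only [Category.assoc, Groupoid.inv_eq_inv, IsIso.inv_hom_id_assoc]
      rw [reassoc_of% e]
    · rw [hk2 u v x hu hx, hk2 v w x hv hx, hk2 u w x hu hx, mul_one]
  obtain ⟨s, hs⟩ := h k hk
  -- Correcting by the trivialization `s` makes this class independent of `v`. Compatibility with
  -- `γ` then reads `β ≫ γ = β`, and `β` cancels.
  let β : ∀ v x (_ : x ∈ U v), Joined p x → ((⟨p⟩ : FundamentalGroupoid X) ⟶ ⟨x⟩) :=
    fun v x hv hx => s v ≫ α v ((hJ v x hv).1 hx) ≫ c v _ _ (hO v) hv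
  have hβ : ∀ u v x hu hv hx, β u x hu hx = β v x hv hx := by
    intro u v x hu hv hx
    simp only [β]
    rw [hs hu hv, hk1 u v x hu hv hx, End.mul_def]
    have e := hcomp v x _ x hv (hO v) hv
    rw [hcself] at e
    simp only [Category.assoc, Groupoid.inv_eq_inv, IsIso.inv_hom_id_assoc]
    rw [e, Category.comp_id]
  have key := FundamentalGroupoid.comp_eq_of_cover hU (fun x => ⟨idx x, hidx x⟩) p
    (fun x hx => β (idx x) x (hidx x) hx) (fun v x y δ hδ hx hy => by
      have hxv : x ∈ U v := by simpa using hδ 0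
      have hyv : y ∈ U v := by simpa using hδ 1
      rw [hβ _ v x _ hxv hx, hβ _ v y _ hyv hy, ← hc v x y hxv hyv δ hδ]
      simp only [β, Category.assoc, hcomp]) γ (Joined.refl p) (Joined.refl p)
  have h1 : ∀ f : (⟨p⟩ : FundamentalGroupoid X) ⟶ ⟨p⟩,
      β (idx p) p (hidx p) (Joined.refl p) ≫ f = β (idx p) p (hidx p) (Joined.refl p) →
        f = 𝟙 _ := fun f hf => by
    rwa [← cancel_epi (β (idx p) p (hidx p) (Joined.refl p)), Category.comp_id]
  exact Path.Homotopic.Quotient.eq.1 (h1 _ key)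

end GoodCovers

/-! ### Open stars in the geometric realization -/

namespace AbstractSimplicialComplex

open scoped unitInterval

variable {V : Type*} {K : AbstractSimplicialComplex V}

namespace Realization

theorem ofSimplex_apply_mem {s : Finset V} (hs : s ∈ K.faces) (x : stdSimplex ℝ s) {v : V}
    (hv : v ∈ s) : (ofSimplex K s hs x).1 v = x ⟨v, hv⟩ :=
  Finsupp.embDomain_apply_self (Function.Embedding.subtype (· ∈ s)) _ ⟨v, hv⟩

theorem ofSimplex_apply_notMem {s : Finset V} (hs : s ∈ K.faces) (x : stdSimplex ℝ s) {v : V}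
    (hv : v ∉ s) : (ofSimplex K s hs x).1 v = 0 :=
  Finsupp.embDomain_of_notMem_range _ _ _ (by simpa using hv)

theorem support_ofSimplex_subset {s : Finset V} (hs : s ∈ K.faces) (x : stdSimplex ℝ s) :
    (ofSimplex K s hs x).1.support ⊆ s := fun v hv => by
  by_contra h
  exact Finsupp.mem_support_iff.1 hv (ofSimplex_apply_notMem hs x h)

theorem exists_ofSimplex_eq (f : K.Realization) {s : Finset V} (hs : s ∈ K.faces)
    (h : f.1.support ⊆ s) : ∃ x, ofSimplex K s hs x = f := by
  refine ⟨⟨fun v => f.1 v, fun v => f.2.1 v, ?_⟩, Subtype.ext (Finsupp.ext fun v => ?_)⟩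
  · rw [Finset.sum_coe_sort s (fun v => f.1 v)]
    refine Eq.trans ?_ f.2.2.1
    exact (Finset.sum_subset h fun v _ hv => Finsupp.notMem_support_iff.1 hv).symm
  · by_cases hv : v ∈ s
    · rw [ofSimplex_apply_mem hs _ hv]; rfl
    · rw [ofSimplex_apply_notMem hs _ hv]
      exact (Finsupp.notMem_support_iff.1 fun h' => hv (h h')).symm

theorem continuous_ofSimplex {s : Finset V} (hs : s ∈ K.faces) : Continuous (ofSimplex K s hs) :=
  continuous_iff_coinduced_le.2
    (le_iSup (fun s : {s : Finset V // s ∈ K.faces} =>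
      TopologicalSpace.coinduced (ofSimplex K s.1 s.2) inferInstance) ⟨s, hs⟩)

theorem isOpen_iff {W : Set K.Realization} :
    IsOpen W ↔ ∀ (s : Finset V) (hs : s ∈ K.faces), IsOpen (ofSimplex K s hs ⁻¹' W) := by
  refine isOpen_iSup_iff.trans ⟨fun h s hs => h ⟨s, hs⟩, fun h s => h s.1 s.2⟩

theorem mem_support_iff_pos {f : K.Realization} {v : V} : v ∈ f.1.support ↔ 0 < f.1 v := by
  rw [Finsupp.mem_support_iff]
  exact ⟨fun h => lt_of_le_of_ne (f.2.1 v) h.symm, fun h => h.ne'⟩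

/-- The point with barycentric coordinates `(1 - t) f + t g`, for `f` and `g` in a closed
simplex. -/
noncomputable def mix (f g : K.Realization)
    (h : ∃ s ∈ K.faces, f.1.support ⊆ s ∧ g.1.support ⊆ s) (t : I) : K.Realization :=
  ⟨(1 - (t : ℝ)) • f.1 + (t : ℝ) • g.1, by
    classical
    obtain ⟨s, hs, hf, hg⟩ := h
    have hsum : (((1 - (t : ℝ)) • f.1 + (t : ℝ) • g.1).sum fun _ r => r) = 1 := by
      rw [Finsupp.sum_add_index' (by simp) (by simp), Finsupp.sum_smul_index (by simp),
        Finsupp.sum_smul_index (by simp), ← Finsupp.mul_sum, ← Finsupp.mul_sum, f.2.2.1, g.2.2.1]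
      ring
    refine ⟨fun v => ?_, hsum, (K.isRelLowerSet_faces hs).2 (fun v hv => ?_) ?_⟩
    · have := t.2.1
      have := t.2.2
      have := f.2.1 v
      have := g.2.1 v
      simp only [Finsupp.add_apply, Finsupp.smul_apply, smul_eq_mul]
      exact add_nonneg (mul_nonneg (by linarith) (by assumption))
        (mul_nonneg (by assumption) (by assumption))
    · by_contra hvs
      refine Finsupp.mem_support_iff.1 hv ?_
      have h1 : f.1 v = 0 := Finsupp.notMem_support_iff.1 fun h' => hvs (hf h')
      have h2 : g.1 v = 0 := Finsupp.notMem_support_iff.1 fun h' => hvs (hg h')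
      simp [h1, h2]
    · rw [Finset.nonempty_iff_ne_empty]
      intro h
      rw [Finsupp.sum, h, Finset.sum_empty] at hsum
      exact zero_ne_one hsum⟩

theorem mix_apply (f g : K.Realization) (h) (t : I) (v : V) :
    (mix f g h t).1 v = (1 - (t : ℝ)) * f.1 v + t * g.1 v := rfl

theorem mix_zero (f g : K.Realization) (h) : mix f g h 0 = f :=
  Subtype.ext (Finsupp.ext fun v => by simp [mix_apply])

theorem mix_one (f g : K.Realization) (h) : mix f g h 1 = g :=
  Subtype.ext (Finsupp.ext fun v => by simp [mix_apply])

theorem mix_pos {f g : K.Realization} (h) (t : I) {v : V} (hf : 0 < f.1 v) (hg : 0 < g.1 v) :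
    0 < (mix f g h t).1 v := by
  rw [mix_apply]
  have := t.2.1
  rcases t.2.2.lt_or_eq with ht | ht
  · exact add_pos_of_pos_of_nonneg (mul_pos (by linarith) hf) (by positivity)
  · rw [ht]; simpa using hg

/-- The convex combination `(1 - t) x + t y` in a standard simplex. -/
noncomputable def simplexMix {s : Finset V} (x y : stdSimplex ℝ s) (t : I) : stdSimplex ℝ s :=
  ⟨(1 - (t : ℝ)) • x.1 + (t : ℝ) • y.1, convex_stdSimplex ℝ s x.2 y.2
    (by linarith [t.2.2]) t.2.1 (by ring)⟩

theorem continuous_simplexMix {s : Finset V} (y : stdSimplex ℝ s) :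
    Continuous fun p : stdSimplex ℝ s × I => simplexMix p.1 y p.2 :=
  Continuous.subtype_mk (by fun_prop) _

theorem mix_ofSimplex {s : Finset V} (hs : s ∈ K.faces) (x y : stdSimplex ℝ s) (h) (t : I) :
    mix (ofSimplex K s hs x) (ofSimplex K s hs y) h t = ofSimplex K s hs (simplexMix x y t) := by
  refine Subtype.ext (Finsupp.ext fun v => ?_)
  rw [mix_apply]
  by_cases hv : v ∈ s
  · simp only [ofSimplex_apply_mem hs _ hv]; rfl
  · simp only [ofSimplex_apply_notMem hs _ hv]; simp

theorem continuous_mix (f g : K.Realization) (h) : Continuous (mix f g h) := by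
  obtain ⟨s, hs, hf, hg⟩ := id h
  obtain ⟨x, rfl⟩ := exists_ofSimplex_eq f hs hf
  obtain ⟨y, rfl⟩ := exists_ofSimplex_eq g hs hg
  simp_rw [funext (mix_ofSimplex hs x y h)]
  exact (continuous_ofSimplex hs).comp
    ((continuous_simplexMix y).comp (Continuous.prodMk_right x))

/-- The open star of a vertex. -/
def star (K : AbstractSimplicialComplex V) (v : V) : Set K.Realization := {f | 0 < f.1 v}

theorem isOpen_preimage_star {s : Finset V} (hs : s ∈ K.faces) (v : V) :
    IsOpen (ofSimplex K s hs ⁻¹' star K v) := by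
  by_cases hv : v ∈ s
  · have : ofSimplex K s hs ⁻¹' star K v = {x : stdSimplex ℝ s | 0 < x.1 ⟨v, hv⟩} := by
      ext x
      simp only [star, Set.mem_preimage, Set.mem_ofPred_eq, ofSimplex_apply_mem hs _ hv]
      rfl
    rw [this]
    exact isOpen_lt continuous_const ((continuous_apply _).comp continuous_subtype_val)
  · have : ofSimplex K s hs ⁻¹' star K v = ∅ := by
      ext x
      simp [star, ofSimplex_apply_notMem hs _ hv]
    rw [this]
    exact isOpen_empty

theorem isOpen_star (v : V) : IsOpen (star K v) :=
  isOpen_iff.2 fun _ hs => isOpen_preimage_star hs v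

/-- A vertex, as a point of the geometric realization. -/
noncomputable def vertex (K : AbstractSimplicialComplex V) (v : V) : K.Realization :=
  ⟨Finsupp.single v 1, fun w => by
    classical
    rw [Finsupp.single_apply]; split_ifs <;> simp, by simp, by
    rw [Finsupp.support_single v (one_ne_zero (α := ℝ))]; exact K.singleton_mem v⟩

theorem support_vertex (v : V) : (vertex K v).1.support = {v} :=
  Finsupp.support_single v (one_ne_zero (α := ℝ))

theorem vertex_mem_star (v : V) : vertex K v ∈ star K v := by
  change 0 < (Finsupp.single v (1 : ℝ)) v
  simp

theorem exists_mem_star (f : K.Realization) : ∃ v, f ∈ star K v := by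
  obtain ⟨v, hv⟩ := (K.isRelLowerSet_faces f.2.2.2).1
  exact ⟨v, mem_support_iff_pos.1 hv⟩

theorem common_face_of_mem_star {f : K.Realization} {v : V} (hf : f ∈ star K v) :
    ∃ s ∈ K.faces, f.1.support ⊆ s ∧ (vertex K v).1.support ⊆ s :=
  ⟨_, f.2.2.2, subset_rfl, by
    rw [support_vertex, Finset.singleton_subset_iff, mem_support_iff_pos]; exact hf⟩

open Classical in
/-- The straight path from a point of the open star of `v` to `v`, and a constant path elsewhere. -/
noncomputable def contraction (v : V) (f : K.Realization) : C(I, K.Realization) :=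
  if h : f ∈ star K v then ⟨_, continuous_mix f (vertex K v) (common_face_of_mem_star h)⟩
  else .const _ f

theorem contraction_apply {v : V} {f : K.Realization} (h : f ∈ star K v) (t : I) :
    contraction v f t = mix f (vertex K v) (common_face_of_mem_star h) t := by
  rw [contraction, dif_pos h]; rfl

/-- The weak topology tests maps out of `|K|` on closed simplices, but gives no such test on the
product with the interval. Currying the time variable avoids the product: on a simplex containing
`v` the map is a curried linear homotopy, and the other simplices miss the star. -/
theorem continuousOn_contraction (v : V) : ContinuousOn (contraction v) (star K v) := by
  rw [continuousOn_open_iff (isOpen_star v)]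
  intro T hT
  rw [isOpen_iff]
  intro s hs
  by_cases hv : v ∈ s
  · obtain ⟨y, hy⟩ := exists_ofSimplex_eq (vertex K v) hs (by simpa [support_vertex] using hv)
    let Ψ : C(stdSimplex ℝ s, C(I, K.Realization)) := ContinuousMap.curry
      ⟨fun p => ofSimplex K s hs (simplexMix p.1 y p.2),
        (continuous_ofSimplex hs).comp (continuous_simplexMix y)⟩
    have : ofSimplex K s hs ⁻¹' (star K v ∩ contraction v ⁻¹' T) =
        ofSimplex K s hs ⁻¹' star K v ∩ Ψ ⁻¹' T := by
      ext x
      simp only [Set.preimage_inter, Set.mem_inter_iff, Set.mem_preimage, and_congr_right_iff]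
      intro hx
      have : contraction v (ofSimplex K s hs x) = Ψ x := by
        ext1 t
        rw [contraction_apply hx]
        simp only [← hy]
        exact mix_ofSimplex hs x y _ t
      rw [this]
    rw [this]
    exact (isOpen_preimage_star hs v).inter (hT.preimage Ψ.continuous)
  · have : ofSimplex K s hs ⁻¹' (star K v ∩ contraction v ⁻¹' T) = ∅ := by
      ext x
      simp [star, ofSimplex_apply_notMem hs _ hv]
    rw [this]
    exact isOpen_empty

theorem contractibleSpace_star (v : V) : ContractibleSpace (star K v) := by
  rw [contractible_iff_id_nullhomotopic]
  refine ⟨⟨vertex K v, vertex_mem_star v⟩, ⟨?_⟩⟩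
  have hΦ : Continuous fun f : star K v => contraction v f.1 :=
    (continuousOn_contraction v).comp_continuous continuous_subtype_val fun f => f.2
  exact
    { toFun := fun p => ⟨contraction v p.2.1 p.1, by
        rw [contraction_apply p.2.2]
        exact mix_pos _ _ p.2.2 (vertex_mem_star v)⟩
      continuous_toFun := by
        refine Continuous.subtype_mk ?_ _
        exact (hΦ.comp continuous_snd).eval continuous_fst
      map_zero_left := fun f => by
        ext1
        simp [contraction_apply f.2, mix_zero]
      map_one_left := fun f => by
        ext1
        simp [contraction_apply f.2, mix_one] }

theorem isSimplyConnected_star (v : V) : IsSimplyConnected (star K v) :=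
  have := contractibleSpace_star (K := K) v
  SimplyConnectedSpace.ofContractible _

theorem exists_mem_star_of_mem_faces {s : Finset V} (hs : s ∈ K.faces) :
    ∃ f : K.Realization, f.1.support ⊆ s ∧ ∀ v ∈ s, f ∈ star K v := by
  have : Nonempty s := (K.isRelLowerSet_faces hs).1.coe_sort
  refine ⟨ofSimplex K s hs stdSimplex.barycenter, support_ofSimplex_subset _ _, fun v hv => ?_⟩
  rw [star, Set.mem_ofPred_eq, ofSimplex_apply_mem hs _ hv]
  change 0 < (Fintype.card _ : ℝ)⁻¹
  exact inv_pos.2 (Nat.cast_pos.2 Fintype.card_pos)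

/-- If the stars meet, `{u, v}` is a simplex. The segment from any point of the intersection to the
barycentre of `{u, v}` lies in a closed simplex and keeps both coordinates positive. -/
theorem isPathConnected_star_inter_star {u v : V} (h : (star K u ∩ star K v).Nonempty) :
    IsPathConnected (star K u ∩ star K v) := by
  classical
  obtain ⟨f, hfu, hfv⟩ := h
  have hf : ∀ {f : K.Realization}, f ∈ star K u → f ∈ star K v →
      {u, v} ⊆ f.1.support := fun hu hv => by
    simp only [Finset.insert_subset_iff, Finset.singleton_subset_iff]
    exact ⟨mem_support_iff_pos.2 hu, mem_support_iff_pos.2 hv⟩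
  have huv : {u, v} ∈ K.faces := (K.isRelLowerSet_faces f.2.2.2).2 (hf hfu hfv) (by simp)
  obtain ⟨m, hm, hms⟩ := exists_mem_star_of_mem_faces huv
  have hmu := hms u (by simp)
  have hmv := hms v (by simp)
  refine ⟨m, ⟨hmu, hmv⟩, fun g hg => JoinedIn.symm ?_⟩
  have hc : ∃ s ∈ K.faces, g.1.support ⊆ s ∧ m.1.support ⊆ s :=
    ⟨_, g.2.2.2, subset_rfl, hm.trans (hf hg.1 hg.2)⟩
  exact ⟨⟨⟨_, continuous_mix g m hc⟩, mix_zero g m hc, mix_one g m hc⟩, fun t =>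
    ⟨mix_pos hc t hg.1 hmu, mix_pos hc t hg.2 hmv⟩⟩

end Realization

/-! ### Simplicial cocycles and the star cover -/

/-- Group-valued simplicial `1`-cocycles. -/
def IsCocycle (K : AbstractSimplicialComplex V) {G : Type*} [Group G] (k : V → V → G) : Prop :=
  ∀ s ∈ K.faces, ∀ u ∈ s, ∀ v ∈ s, ∀ w ∈ s, k v w * k u v = k u w

/-- Group-valued simplicial `1`-coboundaries. -/
def IsCoboundary (K : AbstractSimplicialComplex V) {G : Type*} [Group G] (k : V → V → G) : Prop :=
  ∃ c : V → G, ∀ s ∈ K.faces, ∀ u ∈ s, ∀ v ∈ s, c v = k u v * c u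

/-- The nerve of the star cover is `K`: a point lies in the stars of the vertices of its support,
and the vertices of a simplex have its barycentre in all their stars. -/
theorem isCoverCocycle_star_iff {G : Type*} [Group G] {k : V → V → G} :
    IsCoverCocycle (Realization.star K) k ↔ K.IsCocycle k := by
  constructor
  · intro h s hs u hu v hv w hw
    obtain ⟨f, -, hf⟩ := Realization.exists_mem_star_of_mem_faces hs
    exact h (hf u hu) (hf v hv) (hf w hw)
  · intro h f u v w hu hv hw
    exact h _ f.2.2.2 u (Realization.mem_support_iff_pos.2 hu) v (Realization.mem_support_iff_pos.2 hv)
      w (Realization.mem_support_iff_pos.2 hw)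

theorem isCoverCoboundary_star_iff {G : Type*} [Group G] {k : V → V → G} :
    IsCoverCoboundary (Realization.star K) k ↔ K.IsCoboundary k := by
  constructor
  · rintro ⟨c, h⟩
    refine ⟨c, fun s hs u hu v hv => ?_⟩
    obtain ⟨f, -, hf⟩ := Realization.exists_mem_star_of_mem_faces hs
    exact h (hf u hu) (hf v hv)
  · rintro ⟨c, h⟩
    exact ⟨c, fun f u v hu hv => h _ f.2.2.2 u (Realization.mem_support_iff_pos.2 hu) v
      (Realization.mem_support_iff_pos.2 hv)⟩

end AbstractSimplicialComplex

/-- The path components of `|K|` are simply connected if and only if all `1`-cocycles on `K` with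
values in a group are coboundaries. -/
theorem AbstractSimplicialComplex.forall_simplyConnectedSpace_iff.{u} {V : Type u}
    (K : AbstractSimplicialComplex V) :
    (∀ x : K.Realization, SimplyConnectedSpace (pathComponent x)) ↔
      ∀ (G : Type u) [Group G] (k : V → V → G), K.IsCocycle k → K.IsCoboundary k := by
  constructor
  · intro h G _ k hk
    rw [← isCoverCoboundary_star_iff]
    exact isCoverCoboundary_of_simplyConnectedSpace (isCoverCocycle_star_iff.2 hk)
      Realization.isOpen_star Realization.exists_mem_star
      (fun v => (Realization.isSimplyConnected_star v).isPathConnected) h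
  · intro h
    refine simplyConnectedSpace_pathComponent_of_homotopic_refl fun p γ => ?_
    refine homotopic_refl_of_isCoverCoboundary Realization.isOpen_star Realization.exists_mem_star
      Realization.isSimplyConnected_star
      (fun u v => Realization.isPathConnected_star_inter_star) p (fun k hk => ?_) γ
    rw [isCoverCoboundary_star_iff]
    exact h _ k (isCoverCocycle_star_iff.1 hk)

/-! ### Vertices of `Y(A)` and matrices -/

namespace GE2

variable {A : Type*} [CommRing A]

local notation "SL" => Matrix.SpecialLinearGroup (Fin 2) A

theorem det_eq (g : SL) : g 0 0 * g 1 1 - g 0 1 * g 1 0 = 1 := by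
  rw [← Matrix.det_fin_two, g.2]

/-- The class of the first row of a matrix in `SL₂(A)`. -/
def vertexOf (g : Matrix.SpecialLinearGroup (Fin 2) A) : Vertex A :=
  Quotient.mk (rowSetoid A) ⟨(g 0 0, g 0 1), g 1 1, -g 1 0, by
    have := det_eq g
    linear_combination this⟩

theorem vertexOf_surjective : Function.Surjective (vertexOf (A := A)) := by
  intro x
  obtain ⟨⟨⟨a, b⟩, r, s, h⟩, rfl⟩ := Quotient.exists_rep x
  refine ⟨⟨!![a, b; -s, r], ?_⟩, rfl⟩
  rw [Matrix.det_fin_two_of]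
  linear_combination h

theorem mul_inv_apply_zero_one (g g' : SL) :
    (g' * g⁻¹) 0 1 = g' 0 1 * g 0 0 - g' 0 0 * g 0 1 := by
  rw [Matrix.SpecialLinearGroup.coe_mul, Matrix.SpecialLinearGroup.coe_inv,
    Matrix.adjugate_fin_two, Matrix.mul_apply, Fin.sum_univ_two]
  simp
  ring

/-- The entry is, up to sign, the determinant of the two first rows. When it vanishes, `g' * g⁻¹` is
lower triangular and its upper left entry is the unit relating the rows. -/
theorem vertexOf_eq_iff {g g' : SL} : vertexOf g = vertexOf g' ↔ (g' * g⁻¹) 0 1 = 0 := by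
  rw [mul_inv_apply_zero_one]
  have d := det_eq g
  have d' := det_eq g'
  constructor
  · intro h
    obtain ⟨c, hc⟩ := Quotient.exact h
    simp only [Prod.mk.injEq] at hc
    rw [hc.1, hc.2]
    ring
  · intro h
    refine Quotient.sound ⟨⟨g' 0 0 * g 1 1 - g' 0 1 * g 1 0, g 0 0 * g' 1 1 - g 0 1 * g' 1 0,
      ?_, ?_⟩, ?_⟩
    · linear_combination (g 0 0 * g 1 1 - g 0 1 * g 1 0) * d' + d -
        (g 1 0 * g' 1 1 - g 1 1 * g' 1 0) * h
    · linear_combination (g 0 0 * g 1 1 - g 0 1 * g 1 0) * d' + d -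
        (g 1 0 * g' 1 1 - g 1 1 * g' 1 0) * h
    · ext
      · simp only
        linear_combination -(g' 0 0) * d + g 1 0 * h
      · simp only
        linear_combination -(g' 0 1) * d + g 1 1 * h

theorem isUnit_of_adj {g g' : SL} (h : (graph A).Adj (vertexOf g) (vertexOf g')) :
    IsUnit ((g' * g⁻¹) 0 1) := by
  obtain ⟨-, u, v, hu, hv, hdet⟩ := h
  obtain ⟨c, hc⟩ := Quotient.exact hu
  obtain ⟨d, hd⟩ := Quotient.exact hv
  simp only [Prod.ext_iff] at hc hd
  rw [mul_inv_apply_zero_one, hc.1, hc.2, hd.1, hd.2]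
  rw [Matrix.det_fin_two_of] at hdet
  convert (c * d).isUnit.mul hdet using 1
  push_cast
  ring

theorem adj_of_isUnit [Nontrivial A] {g g' : SL} (h : IsUnit ((g' * g⁻¹) 0 1)) :
    (graph A).Adj (vertexOf g) (vertexOf g') := by
  refine ⟨fun h' => h.ne_zero (vertexOf_eq_iff.1 h'), _, _, rfl, rfl, ?_⟩
  rw [mul_inv_apply_zero_one] at h
  rw [Matrix.det_fin_two_of]
  convert h using 1
  ring

/-- Two vertices are near if they lie in a common simplex of `Y(A)`. -/
def Near (x y : Vertex A) : Prop := x = y ∨ (graph A).Adj x y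

theorem Near.symm {x y : Vertex A} (h : Near x y) : Near y x :=
  h.imp Eq.symm SimpleGraph.Adj.symm

theorem near_of_isUnit {g g' : SL} (h : IsUnit ((g' * g⁻¹) 0 1)) :
    Near (vertexOf g) (vertexOf g') := by
  rcases subsingleton_or_nontrivial A with hA | hA
  · exact Or.inl (vertexOf_eq_iff.2 (Subsingleton.elim _ _))
  · exact Or.inr (adj_of_isUnit h)

theorem near_of_mem_faces {s : Finset (Vertex A)} (hs : s ∈ (Y A).faces) {x y : Vertex A}
    (hx : x ∈ s) (hy : y ∈ s) : Near x y := by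
  by_cases h : x = y
  · exact Or.inl h
  · exact Or.inr (hs.2 hx hy h)

/-- In a clique complex, pairwise near vertices already span a simplex. -/
theorem isCocycle_iff {G : Type*} [Group G] {k : Vertex A → Vertex A → G} :
    (Y A).IsCocycle k ↔
      ∀ x y z, Near x y → Near y z → Near x z → k y z * k x y = k x z := by
  classical
  constructor
  · intro h x y z hxy hyz hxz
    refine h {x, y, z} ⟨by simp, ?_⟩ x (by simp) y (by simp) z (by simp)
    intro a ha b hb hab
    simp only [Finset.coe_insert, Finset.coe_singleton, Set.mem_insert_iff,
      Set.mem_singleton_iff] at ha hb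
    have key : Near a b := by
      rcases ha with rfl | rfl | rfl <;> rcases hb with rfl | rfl | rfl <;>
        first | exact Or.inl rfl | assumption | exact Near.symm (by assumption)
    exact key.resolve_left hab
  · intro h s hs x hx y hy z hz
    exact h x y z (near_of_mem_faces hs hx hy) (near_of_mem_faces hs hy hz)
      (near_of_mem_faces hs hx hz)

theorem isCoboundary_iff {G : Type*} [Group G] {k : Vertex A → Vertex A → G} :
    (Y A).IsCoboundary k ↔ ∃ c : Vertex A → G, ∀ x y, Near x y → c y = k x y * c x := by
  classical
  constructor
  · rintro ⟨c, h⟩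
    refine ⟨c, fun x y hxy => h {x, y} ⟨by simp, ?_⟩ x (by simp) y (by simp)⟩
    intro a ha b hb hab
    simp only [Finset.coe_insert, Finset.coe_singleton, Set.mem_insert_iff,
      Set.mem_singleton_iff] at ha hb
    have key : Near a b := by
      rcases ha with rfl | rfl <;> rcases hb with rfl | rfl <;>
        first | exact Or.inl rfl | assumption | exact Near.symm (by assumption)
    exact key.resolve_left hab
  · rintro ⟨c, h⟩
    exact ⟨c, fun s hs x hx y hy => h x y (near_of_mem_faces hs hx hy)⟩

/-- The diagonal matrix `diag(u, u⁻¹)`. -/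
def diag (u : Aˣ) : Matrix.SpecialLinearGroup (Fin 2) A :=
  ⟨!![(u : A), 0; 0, ((u⁻¹ : Aˣ) : A)], by simp [Matrix.det_fin_two_of]⟩

theorem coe_diag (u : Aˣ) : (diag u : Matrix (Fin 2) (Fin 2) A) =
    !![(u : A), 0; 0, ((u⁻¹ : Aˣ) : A)] := rfl

theorem lift_hWord_eq (u : Aˣ) : FreeGroup.lift (E : A → SL) (hWord u) = diag u :=
  Subtype.ext (lift_hWord u)

theorem diag_eq (u : Aˣ) : E (-(u : A)) * (E (-((u⁻¹ : Aˣ) : A)) * E (-(u : A))) = diag u := by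
  rw [← lift_hWord_eq, hWord]
  simp [mul_assoc]

theorem vertexOf_mul {m g : SL} (h : m 0 1 = 0) : vertexOf (m * g) = vertexOf g :=
  (vertexOf_eq_iff.2 (by simpa using h)).symm

theorem vertexOf_diag_mul (u : Aˣ) (g : SL) : vertexOf (diag u * g) = vertexOf g :=
  vertexOf_mul (by simp [coe_diag])

theorem near_mul {m g : SL} (h : IsUnit (m 0 1)) : Near (vertexOf g) (vertexOf (m * g)) :=
  near_of_isUnit (by simpa using h)

theorem near_E (a : A) (g : SL) : Near (vertexOf g) (vertexOf (E a * g)) :=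
  near_mul (by simp [coe_E])

/-! ### Cocycles on `Y(A)` for `A` universal for `GE₂` -/

theorem exists_eq_diag_mul {m : SL} (h : m 0 1 = 0) :
    ∃ (u : Aˣ) (x : A), m = diag u * ((E 0)⁻¹ * E x) := by
  have hd := det_eq m
  rw [h, zero_mul, sub_zero] at hd
  refine ⟨⟨m 0 0, m 1 1, hd, by rw [mul_comm]; exact hd⟩, m 0 0 * m 1 0, ?_⟩
  refine Matrix.SpecialLinearGroup.ext _ _ fun i j => ?_
  rw [Matrix.SpecialLinearGroup.coe_mul, Matrix.SpecialLinearGroup.coe_mul,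
    Matrix.SpecialLinearGroup.coe_inv, coe_diag, coe_E, coe_E]
  fin_cases i <;> fin_cases j <;> simp [h]
  linear_combination -(m 1 0) * hd

theorem exists_vertexOf_E_mul {g g' : SL} (h : IsUnit ((g' * g⁻¹) 0 1)) :
    ∃ a, vertexOf (E a * g) = vertexOf g' := by
  obtain ⟨q, hq⟩ := h
  rw [mul_inv_apply_zero_one] at hq
  -- The first row of `g' * g⁻¹` is `q` times the first row `(a, 1)` of `E a`.
  refine ⟨(g' 0 0 * g 1 1 - g' 0 1 * g 1 0) * ((q⁻¹ : Aˣ) : A), ?_⟩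
  have e : ∀ a j, (E a * g) 0 j = a * g 0 j + g 1 j := fun a j => by
    rw [Matrix.SpecialLinearGroup.coe_mul, coe_E, Matrix.mul_apply, Fin.sum_univ_two]
    simp
  rw [vertexOf_eq_iff, mul_inv_apply_zero_one, e, e]
  have h3 := q.inv_mul
  rw [hq] at h3
  linear_combination (g' 0 0 * g 1 1 - g' 0 1 * g 1 0) * h3

section Transport

variable {G : Type*} [Group G] {k : Vertex A → Vertex A → G}

/-- The permutation of `SL₂(A) × G` which multiplies a matrix by `E(a)` and transports the second
coordinate along the corresponding edge by a cocycle. -/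
def transport (k : Vertex A → Vertex A → G) (a : A) :
    Equiv.Perm (Matrix.SpecialLinearGroup (Fin 2) A × G) where
  toFun p := (E a * p.1, k (vertexOf p.1) (vertexOf (E a * p.1)) * p.2)
  invFun p := ((E a)⁻¹ * p.1, (k (vertexOf ((E a)⁻¹ * p.1)) (vertexOf p.1))⁻¹ * p.2)
  left_inv p := by simp
  right_inv p := by simp

theorem transport_apply (a : A) (g : SL) (t : G) :
    transport k a (g, t) = (E a * g, k (vertexOf g) (vertexOf (E a * g)) * t) := rfl

theorem lift_transport_fst (w : FreeGroup A) (p : SL × G) :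
    (FreeGroup.lift (transport k) w p).1 = FreeGroup.lift E w * p.1 := by
  induction w using FreeGroup.induction_on generalizing p with
  | C1 => simp
  | of a => simp [transport]
  | inv_of a _ => simp [transport, Equiv.Perm.inv_def, Equiv.symm]
  | mul x y hx hy => simp [hx, hy, mul_assoc]

variable (hk : ∀ x y z, Near x y → Near y z → Near x z → k y z * k x y = k x z)
include hk

theorem cocycle_self (x : Vertex A) : k x x = 1 := by
  simpa using hk x x x (Or.inl rfl) (Or.inl rfl) (Or.inl rfl)

theorem cocycle_mul_symm {x y : Vertex A} (h : Near x y) : k y x * k x y = 1 := by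
  rw [hk x y x h h.symm (Or.inl rfl), cocycle_self hk]

/-- The word `h(u)` traces the boundary of a triangle: its third step returns to the starting vertex
because the product of the matrices is diagonal. -/
theorem cocycle_triangle (u : Aˣ) (g : SL) :
    k (vertexOf (E (-((u⁻¹ : Aˣ) : A)) * (E (-(u : A)) * g)))
        (vertexOf (E (-(u : A)) * (E (-((u⁻¹ : Aˣ) : A)) * (E (-(u : A)) * g)))) *
      (k (vertexOf (E (-(u : A)) * g)) (vertexOf (E (-((u⁻¹ : Aˣ) : A)) * (E (-(u : A)) * g))) *
        k (vertexOf g) (vertexOf (E (-(u : A)) * g))) = 1 := by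
  have h02 : Near (vertexOf g) (vertexOf (E (-((u⁻¹ : Aˣ) : A)) * (E (-(u : A)) * g))) := by
    rw [← mul_assoc]
    refine near_mul ?_
    rw [Matrix.SpecialLinearGroup.coe_mul, coe_E, coe_E]
    simp
  rw [hk _ _ _ (near_E _ _) (near_E _ _) h02, ← mul_assoc, ← mul_assoc, mul_assoc (E _), diag_eq,
    vertexOf_diag_mul, cocycle_mul_symm hk h02]

theorem lift_transport_hWord (u : Aˣ) (g : SL) (t : G) :
    FreeGroup.lift (transport k) (hWord u) (g, t) = (diag u * g, t) := by
  refine Prod.ext ?_ ?_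
  · rw [lift_transport_fst, lift_hWord_eq]
  · simp only [hWord, map_mul, FreeGroup.lift_apply_of, Equiv.Perm.mul_apply, transport_apply]
    rw [← mul_assoc, ← mul_assoc, mul_assoc (k _ _), cocycle_triangle hk, one_mul]

/-- The factors `h(u)` have trivial transport and fix the vertex of `g`. The second relation
remains: its path goes along the edge of `ε(b)`, back by `ε(0)`, then along the edge of `ε(a + b)`.
-/
theorem lift_transport_relators : ∀ w ∈ relators A, FreeGroup.lift (transport k) w = 1 := by
  intro w hw
  have h1 := lift_relators w hw
  rcases hw with (⟨u, v, rfl⟩ | ⟨a, b, rfl⟩) | ⟨u, a, rfl⟩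
  all_goals
    rw [map_mul, map_inv, mul_inv_eq_one] at h1 ⊢
    refine Equiv.ext fun p => Prod.ext ?_ ?_
    · rw [lift_transport_fst, lift_transport_fst, h1]
  · obtain ⟨g, t⟩ := p
    rw [map_mul, Equiv.Perm.mul_apply, lift_transport_hWord hk, lift_transport_hWord hk,
      lift_transport_hWord hk]
  · obtain ⟨g, t⟩ := p
    have e : E a * (E 0 * (E b * g)) = diag (-1) * (E (a + b) * g) := by
      simpa only [map_mul, FreeGroup.lift_apply_of, lift_hWord_eq, mul_assoc] using
        congrArg (· * g) h1
    have e2 : vertexOf (E 0 * (E b * g)) = vertexOf g := by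
      rw [← mul_assoc]
      refine vertexOf_mul ?_
      rw [Matrix.SpecialLinearGroup.coe_mul, coe_E, coe_E]
      simp
    simp only [map_mul, Equiv.Perm.mul_apply, lift_transport_hWord hk, FreeGroup.lift_apply_of,
      transport_apply]
    rw [e, e2, vertexOf_diag_mul, ← mul_assoc (k (vertexOf (E b * g)) _),
      cocycle_mul_symm hk (near_E b g), one_mul]
  · obtain ⟨g, t⟩ := p
    have e : diag u * (E a * (diag u * g)) = E ((u : A) ^ 2 * a) * g := by
      simpa only [map_mul, FreeGroup.lift_apply_of, lift_hWord_eq, mul_assoc] using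
        congrArg (· * g) h1
    simp only [map_mul, Equiv.Perm.mul_apply, lift_transport_hWord hk, FreeGroup.lift_apply_of,
      transport_apply]
    rw [← e, vertexOf_diag_mul, vertexOf_diag_mul]

/-- If `A` is universal for `GE₂`, then a cocycle is trivialized by a function on `SL₂(A)`. -/
theorem exists_trivialization (hA : IsUniversalForGE2 A) :
    ∃ s : SL → G, ∀ a g, s (E a * g) = k (vertexOf g) (vertexOf (E a * g)) * s g := by
  let Ψ : C A →* Equiv.Perm (SL × G) := PresentedGroup.toGroup (lift_transport_relators hk)
  have hΨ : ∀ a, Ψ (PresentedGroup.of a) = transport k a := fun a => PresentedGroup.toGroup.of _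
  have hψ : ∀ a, psi A (PresentedGroup.of a) = E a := fun a => PresentedGroup.toGroup.of _
  let S : Setoid SL := MulAction.orbitRel (psi A).range SL
  let r : SL → SL := fun g => (Quotient.mk S g).out
  have hr : ∀ g, ∃ c, psi A c * r g = g := fun g => by
    obtain ⟨⟨_, c, rfl⟩, hc⟩ := Setoid.symm (Quotient.mk_out (s := S) g)
    exact ⟨c, hc⟩
  have hr' : ∀ c g, r (psi A c * g) = r g := fun c g => by
    have : Quotient.mk S (psi A c * g) = Quotient.mk S g :=
      Quotient.sound ⟨⟨_, c, rfl⟩, rfl⟩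
    simp only [r, this]
  choose c hc using hr
  have hfst : ∀ d p, (Ψ d p).1 = psi A d * p.1 := by
    intro d p
    obtain ⟨w, rfl⟩ := PresentedGroup.mk_surjective _ d
    exact lift_transport_fst w p
  -- The trivialization is `1` on orbit representatives and is spread by the action. Injectivity of
  -- `ψ` makes `c g` the only element carrying `r g` to `g`.
  refine ⟨fun g => (Ψ (c g) (r g, 1)).2, fun a g => ?_⟩
  have h1 : c (E a * g) = PresentedGroup.of a * c g := by
    apply hA
    apply mul_right_cancel (b := r g)
    rw [map_mul, hψ, mul_assoc, hc g]
    have := hc (E a * g)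
    rwa [← hψ a, hr', hψ] at this
  have h2 : r (E a * g) = r g := by rw [← hψ a, hr']
  have h3 : Ψ (c g) (r g, 1) = (g, (Ψ (c g) (r g, 1)).2) :=
    Prod.ext (by rw [hfst, hc]) rfl
  simp only
  rw [h1, h2, map_mul, Equiv.Perm.mul_apply, hΨ, h3, transport_apply]

theorem isCoboundary_of_isUniversalForGE2 (hA : IsUniversalForGE2 A) :
    ∃ c : Vertex A → G, ∀ x y, Near x y → c y = k x y * c x := by
  obtain ⟨s, hs⟩ := exists_trivialization hk hA
  have hdiag : ∀ u g, s (diag u * g) = s g := fun u g => by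
    rw [← diag_eq, mul_assoc, mul_assoc, hs, hs, hs, ← mul_assoc, ← mul_assoc,
      mul_assoc (k _ _), cocycle_triangle hk, one_mul]
  -- From `g` and from its translate, the edges of `E x` and `E 0` respectively lead to the same
  -- matrix and join the same vertices.
  have hlow : ∀ x g, s ((E 0)⁻¹ * E x * g) = s g := fun x g => by
    have h1 : vertexOf ((E 0)⁻¹ * E x * g) = vertexOf g := by
      refine vertexOf_mul ?_
      rw [Matrix.SpecialLinearGroup.coe_mul, Matrix.SpecialLinearGroup.coe_inv, coe_E, coe_E]
      simp
    have h2 := hs 0 ((E 0)⁻¹ * E x * g)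
    rw [h1, mul_assoc, mul_inv_cancel_left, hs x g] at h2
    rw [mul_assoc]
    exact (mul_left_cancel h2).symm
  have hvert : ∀ g g', vertexOf g = vertexOf g' → s g = s g' := by
    intro g g' h
    obtain ⟨u, x, e⟩ := exists_eq_diag_mul (vertexOf_eq_iff.1 h)
    rw [mul_inv_eq_iff_eq_mul, mul_assoc] at e
    rw [e, hdiag, hlow]
  choose M hM using vertexOf_surjective (A := A)
  refine ⟨fun x => s (M x), fun x y hxy => ?_⟩
  rcases hxy with rfl | hxy
  · rw [cocycle_self hk, one_mul]
  · rw [← hM x, ← hM y] at hxy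
    obtain ⟨a, ha⟩ := exists_vertexOf_E_mul (isUnit_of_adj hxy)
    have h1 := hs a (M x)
    rwa [hvert _ _ ha, ha, hM, hM] at h1

end Transport

/-! ### Identities in `C(A)` -/

/-- The generator `ε(a)` of `C(A)`. -/
def eps (a : A) : C A := PresentedGroup.of a

/-- The element `h(u)` of `C(A)`. -/
def hElt (u : Aˣ) : C A := PresentedGroup.mk (relators A) (hWord u)

/-- The element of `C(A)` above a lower unitriangular matrix. -/
def low (a : A) : C A := (eps 0)⁻¹ * eps a

theorem hElt_eq (u : Aˣ) :
    hElt u = eps (-(u : A)) * eps (-((u⁻¹ : Aˣ) : A)) * eps (-(u : A)) := rfl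

theorem hElt_mul (u v : Aˣ) : hElt u * hElt v = hElt (u * v) := by
  have h := PresentedGroup.one_of_mem (rels := relators A) (Or.inl (Or.inl ⟨u, v, rfl⟩))
  rw [map_mul, map_inv, mul_inv_eq_one] at h
  exact h

theorem eps_zero_mul (a b : A) : eps a * eps 0 * eps b = hElt (-1) * eps (a + b) := by
  have h := PresentedGroup.one_of_mem (rels := relators A) (Or.inl (Or.inr ⟨a, b, rfl⟩))
  rw [map_mul, map_inv, mul_inv_eq_one] at h
  exact h

theorem hElt_eps_hElt (u : Aˣ) (a : A) : hElt u * eps a * hElt u = eps ((u : A) ^ 2 * a) := by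
  have h := PresentedGroup.one_of_mem (rels := relators A) (Or.inr ⟨u, a, rfl⟩)
  rw [map_mul, map_inv, mul_inv_eq_one] at h
  exact h

theorem hElt_one : hElt (1 : Aˣ) = 1 := by
  have h := hElt_mul (1 : Aˣ) 1
  rwa [one_mul, mul_eq_left] at h

theorem hElt_inv (u : Aˣ) : (hElt u)⁻¹ = hElt u⁻¹ := by
  rw [inv_eq_iff_mul_eq_one, hElt_mul, mul_inv_cancel, hElt_one]

theorem hElt_neg_one_mul_self : hElt (-1 : Aˣ) * hElt (-1) = 1 := by
  rw [hElt_mul, neg_mul_neg, one_mul, hElt_one]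

theorem eps_mul_hElt (a : A) (u : Aˣ) :
    eps a * hElt u = hElt u⁻¹ * eps ((u : A) ^ 2 * a) := by
  rw [← hElt_inv, eq_inv_mul_iff_mul_eq, ← mul_assoc, hElt_eps_hElt]

theorem hElt_mul_eps (u : Aˣ) (a : A) :
    hElt u * eps a = eps ((u : A) ^ 2 * a) * hElt u⁻¹ := by
  rw [← hElt_inv, eq_mul_inv_iff_mul_eq, hElt_eps_hElt]

theorem eps_zero_mul_hElt (u : Aˣ) : eps (0 : A) * hElt u = hElt u⁻¹ * eps 0 := by
  rw [eps_mul_hElt, mul_zero]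

theorem hElt_neg_one_comm (a : A) : hElt (-1) * eps a = eps a * hElt (-1) := by
  rw [hElt_mul_eps]
  simp

theorem eps_zero_sq : eps (0 : A) * eps 0 = hElt (-1) := by
  have h := eps_zero_mul (0 : A) 0
  rw [add_zero] at h
  exact mul_right_cancel h

theorem eps_zero_inv : (eps (0 : A))⁻¹ = hElt (-1) * eps 0 := by
  rw [inv_eq_iff_mul_eq_one, ← mul_assoc, ← hElt_neg_one_comm, mul_assoc, eps_zero_sq,
    hElt_neg_one_mul_self]

theorem eps_mul_low (a b : A) : eps a * low b = eps (a + b) := by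
  rw [low, eps_zero_inv, ← mul_assoc, ← mul_assoc, ← hElt_neg_one_comm, mul_assoc (hElt (-1)),
    mul_assoc (hElt (-1)), eps_zero_mul, ← mul_assoc, hElt_neg_one_mul_self, one_mul]

theorem low_mul_low (a b : A) : low a * low b = low (a + b) := by
  rw [low, mul_assoc, eps_mul_low, low]

theorem low_zero : low (0 : A) = 1 := inv_mul_cancel _

theorem low_inv (a : A) : (low a)⁻¹ = low (-a) := by
  rw [inv_eq_iff_mul_eq_one, low_mul_low, add_neg_cancel, low_zero]

theorem hElt_mul_low (u : Aˣ) (a : A) :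
    hElt u * low a = low (((u⁻¹ : Aˣ) : A) ^ 2 * a) * hElt u := by
  have h2 : hElt u * (eps (0 : A))⁻¹ = (eps 0)⁻¹ * hElt u⁻¹ := by
    rw [eq_inv_mul_iff_mul_eq, ← mul_assoc, eps_zero_mul_hElt, mul_assoc, mul_inv_cancel, mul_one]
  rw [low, ← mul_assoc, h2, mul_assoc, hElt_mul_eps, inv_inv, low, mul_assoc]

theorem eps_inv (a : A) : (eps a)⁻¹ = hElt (-1) * low (-a) * eps 0 := by
  rw [inv_eq_iff_mul_eq_one, ← mul_assoc, ← mul_assoc, ← hElt_neg_one_comm,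
    mul_assoc (hElt (-1)), eps_mul_low, add_neg_cancel, mul_assoc, eps_zero_sq,
    hElt_neg_one_mul_self]

theorem eps_inv' (a : A) : (eps a)⁻¹ = eps 0 * (eps (-a) * (eps 0)⁻¹) * hElt (-1) := by
  rw [inv_eq_iff_mul_eq_one]
  simp only [← mul_assoc]
  rw [eps_zero_mul, add_neg_cancel, mul_inv_cancel_right, hElt_neg_one_mul_self]

theorem hElt_neg_one_comm_low (a : A) : hElt (-1) * low a = low a * hElt (-1) := by
  rw [hElt_mul_low]
  simp

/-- This lifts the lower-diagonal-upper factorization of `E(w)` to `C(A)`. It comes from solving the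
definition of `h(-w⁻¹)` for its middle factor `ε(w)`. -/
theorem eps_unit (w : Aˣ) : eps (w : A) =
    low (-((w⁻¹ : Aˣ) : A)) * hElt w * (eps (-((w⁻¹ : Aˣ) : A)) * (eps 0)⁻¹) := by
  have h1 := hElt_eq (-w⁻¹)
  rw [inv_neg, inv_inv, Units.val_neg, Units.val_neg, neg_neg, neg_neg] at h1
  have h2 : eps (w : A) = (eps ((w⁻¹ : Aˣ) : A))⁻¹ * hElt (-w⁻¹) * (eps ((w⁻¹ : Aˣ) : A))⁻¹ := by
    rw [h1]
    group
  have h3 : eps (0 : A) * hElt (-w⁻¹) * eps 0 = hElt w := by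
    rw [eps_zero_mul_hElt, mul_assoc, eps_zero_sq, hElt_mul, inv_neg, inv_inv, neg_mul_neg, mul_one]
  have h4 : hElt (-1 : Aˣ) * (hElt w * hElt (-1)) = hElt w := by
    rw [hElt_mul, hElt_mul]
    simp
  calc eps (w : A) = hElt (-1) * low (-((w⁻¹ : Aˣ) : A)) * eps 0 * hElt (-w⁻¹) *
        (eps 0 * (eps (-((w⁻¹ : Aˣ) : A)) * (eps 0)⁻¹) * hElt (-1)) := by
        rw [h2, ← eps_inv', eps_inv (((w⁻¹ : Aˣ) : A))]
    _ = hElt (-1) * low (-((w⁻¹ : Aˣ) : A)) * (eps 0 * hElt (-w⁻¹) * eps 0) *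
        (eps (-((w⁻¹ : Aˣ) : A)) * (eps 0)⁻¹) * hElt (-1) := by
        simp only [mul_assoc]
    _ = low (-((w⁻¹ : Aˣ) : A)) * (hElt (-1) * (hElt w * hElt (-1))) *
        (eps (-((w⁻¹ : Aˣ) : A)) * (eps 0)⁻¹) := by
        have h5 : eps (-((w⁻¹ : Aˣ) : A)) * (eps 0)⁻¹ * hElt (-1) =
            hElt (-1) * (eps (-((w⁻¹ : Aˣ) : A)) * (eps 0)⁻¹) := by
          rw [eps_zero_inv, ← mul_assoc, ← mul_assoc, ← hElt_neg_one_comm]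
          simp only [mul_assoc]
          rw [← hElt_neg_one_comm, ← mul_assoc (eps _) (hElt _), ← hElt_neg_one_comm, mul_assoc]
        rw [h3, hElt_neg_one_comm_low, mul_assoc, h5]
        simp only [mul_assoc]
    _ = _ := by rw [h4]

/-! ### Normal forms and the section over the big cell -/

/-- The element of `C(A)` above a matrix in the big cell, in terms of its normal form. -/
def cell (s : A) (q : Aˣ) (p : A) : C A := low s * hElt q * eps p

/-- The inner factors merge to `ε(p + s')`. When `p + s'` is a unit, `eps_unit` splits it; its lower
factor moves left past `h(q)` and its upper factor right past `h(q')`. -/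
theorem cell_mul_cell (s p s' p' : A) (q q' w : Aˣ) (hw : (w : A) = p + s') :
    cell s q p * cell s' q' p' = cell (s - ((q⁻¹ : Aˣ) : A) ^ 2 * ((w⁻¹ : Aˣ) : A)) (q * w * q')
      (p' - ((q'⁻¹ : Aˣ) : A) ^ 2 * ((w⁻¹ : Aˣ) : A)) := by
  have h1 : eps p * low s' = eps (w : A) := by rw [eps_mul_low, hw]
  have h2 : (eps (0 : A))⁻¹ * hElt q' = hElt q'⁻¹ * (eps 0)⁻¹ := by
    rw [inv_mul_eq_iff_eq_mul, ← mul_assoc, eps_zero_mul_hElt, inv_inv, mul_inv_cancel_right]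
  have h3 : eps (-((w⁻¹ : Aˣ) : A)) * (eps 0)⁻¹ * hElt q' * eps p' =
      hElt q' * eps (p' - ((q'⁻¹ : Aˣ) : A) ^ 2 * ((w⁻¹ : Aˣ) : A)) := by
    rw [mul_assoc (eps _), h2, ← mul_assoc, eps_mul_hElt, inv_inv, mul_assoc, mul_assoc]
    change _ * (_ * low p') = _
    rw [eps_mul_low]
    ring_nf
  calc cell s q p * cell s' q' p' = low s * hElt q * (eps p * low s') * hElt q' * eps p' := by
        simp only [cell, mul_assoc]
    _ = low s * (hElt q * low (-((w⁻¹ : Aˣ) : A))) * hElt w *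
        (eps (-((w⁻¹ : Aˣ) : A)) * (eps 0)⁻¹ * hElt q' * eps p') := by
        rw [h1, eps_unit]
        simp only [mul_assoc]
    _ = low s * low (((q⁻¹ : Aˣ) : A) ^ 2 * -((w⁻¹ : Aˣ) : A)) * (hElt q * hElt w * hElt q') *
        eps (p' - ((q'⁻¹ : Aˣ) : A) ^ 2 * ((w⁻¹ : Aˣ) : A)) := by
        rw [h3, hElt_mul_low]
        simp only [mul_assoc]
    _ = _ := by
        rw [low_mul_low, hElt_mul, hElt_mul, mul_neg, ← sub_eq_add_neg, cell]

theorem cell_inv (s p : A) (q : Aˣ) : (cell s q p)⁻¹ = cell (-p) (-q) (-s) := by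
  rw [cell, cell, mul_inv_rev, mul_inv_rev, eps_inv, low_inv, hElt_inv, hElt_neg_one_comm_low]
  calc low (-p) * hElt (-1) * eps 0 * (hElt q⁻¹ * low (-s))
      = low (-p) * hElt (-1) * (eps 0 * hElt q⁻¹) * low (-s) := by simp only [mul_assoc]
    _ = low (-p) * (hElt (-1) * hElt q) * (eps 0 * low (-s)) := by
        rw [eps_zero_mul_hElt, inv_inv]
        simp only [mul_assoc]
    _ = _ := by rw [hElt_mul, eps_mul_low, zero_add, neg_mul, one_mul]

/-- The elements of `C(A)` above lower triangular matrices. -/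
def tri (s : A) (q : Aˣ) : C A := low s * hElt q

theorem tri_mul_cell (s s' p : A) (q q' : Aˣ) :
    tri s q * cell s' q' p = cell (s + ((q⁻¹ : Aˣ) : A) ^ 2 * s') (q * q') p := by
  rw [tri, cell, cell, ← low_mul_low, ← hElt_mul]
  simp only [mul_assoc]
  rw [← mul_assoc (hElt q), hElt_mul_low]
  simp only [mul_assoc]

theorem cell_mul_tri_inv (s s' p : A) (q q' : Aˣ) :
    cell s' q' p * (tri s q)⁻¹ = cell s' (q' * q) (((q⁻¹ : Aˣ) : A) ^ 2 * p - s) := by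
  rw [tri, cell, cell, mul_inv_rev, hElt_inv, low_inv, sub_eq_add_neg, ← eps_mul_low, ← hElt_mul]
  simp only [mul_assoc]
  rw [← mul_assoc (eps p), eps_mul_hElt, inv_inv]
  simp only [mul_assoc]

theorem psi_eps (a : A) : psi A (eps a) = E a := PresentedGroup.toGroup.of _

theorem psi_hElt (u : Aˣ) : psi A (hElt u) = diag u := lift_hWord_eq u

theorem psi_low (a : A) : psi A (low a) = (E 0)⁻¹ * E a := by
  rw [low, map_mul, map_inv, psi_eps, psi_eps]

theorem coe_psi_cell (s p : A) (q : Aˣ) : (psi A (cell s q p) : Matrix (Fin 2) (Fin 2) A) =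
    !![(q : A) * p, q; s * q * p - ((q⁻¹ : Aˣ) : A), s * q] := by
  rw [cell, map_mul, map_mul, psi_low, psi_hElt, psi_eps]
  simp only [Matrix.SpecialLinearGroup.coe_mul, Matrix.SpecialLinearGroup.coe_inv, coe_E, coe_diag,
    Matrix.adjugate_fin_two_of]
  simp [sub_eq_add_neg]

/-- The entries `q`, `q p` and `s q` of the matrix determine the normal form. -/
theorem psi_cell_injective {s p s' p' : A} {q q' : Aˣ}
    (h : psi A (cell s q p) = psi A (cell s' q' p')) : cell s q p = cell s' q' p' := by
  have h' := congrArg (fun m : SL => (m : Matrix (Fin 2) (Fin 2) A)) h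
  simp only [coe_psi_cell] at h'
  have h01 := congrFun (congrFun h' 0) 1
  have h00 := congrFun (congrFun h' 0) 0
  have h11 := congrFun (congrFun h' 1) 1
  simp only [Matrix.of_apply, Matrix.cons_val', Matrix.cons_val_zero, Matrix.cons_val_one,
    Matrix.cons_val_fin_one] at h01 h00 h11
  obtain rfl := Units.ext h01
  obtain rfl := q.isUnit.mul_left_cancel h00
  obtain rfl := q.isUnit.mul_right_cancel h11
  rfl

theorem exists_cell {m : SL} (h : IsUnit (m 0 1)) : ∃ s q p, psi A (cell s q p) = m := by
  obtain ⟨q, hq⟩ := h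
  have hd := det_eq m
  rw [← hq] at hd
  have h1 := q.mul_inv
  refine ⟨m 1 1 * ((q⁻¹ : Aˣ) : A), q, ((q⁻¹ : Aˣ) : A) * m 0 0, ?_⟩
  refine Matrix.SpecialLinearGroup.ext _ _ fun i j => ?_
  rw [coe_psi_cell]
  fin_cases i <;> fin_cases j <;> simp [← hq]
  linear_combination ((q⁻¹ : Aˣ) : A) * hd + m 1 0 * h1

theorem exists_psi_tri_mul {g g' : SL} (h : vertexOf g = vertexOf g') :
    ∃ s q, psi A (tri s q) * g = g' := by
  obtain ⟨u, x, e⟩ := exists_eq_diag_mul (vertexOf_eq_iff.1 h)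
  refine ⟨((u⁻¹ : Aˣ) : A) ^ 2 * x, u, ?_⟩
  rw [tri, ← hElt_mul_low, map_mul, psi_hElt, psi_low, ← e, inv_mul_cancel_right]

/-- A set-theoretic section of `ψ` over the big cell. -/
noncomputable def cellSection (m : Matrix.SpecialLinearGroup (Fin 2) A) : C A :=
  open Classical in
  if h : ∃ c, (∃ s q p, cell s q p = c) ∧ psi A c = m then h.choose else 1

theorem cellSection_psi_cell (s p : A) (q : Aˣ) :
    cellSection (psi A (cell s q p)) = cell s q p := by
  have h : ∃ c, (∃ s' q' p', cell s' q' p' = c) ∧ psi A c = psi A (cell s q p) :=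
    ⟨_, ⟨s, q, p, rfl⟩, rfl⟩
  rw [cellSection, dif_pos h]
  obtain ⟨⟨s', q', p', hc⟩, h2⟩ := h.choose_spec
  rw [← hc] at h2 ⊢
  exact psi_cell_injective h2

theorem cellSection_mul {m m' : SL} (h : IsUnit (m 0 1)) (h' : IsUnit (m' 0 1))
    (h'' : IsUnit ((m' * m) 0 1)) : cellSection m' * cellSection m = cellSection (m' * m) := by
  obtain ⟨s, q, p, rfl⟩ := exists_cell h
  obtain ⟨s', q', p', rfl⟩ := exists_cell h'
  -- The upper right entry of the product is `q' q (p' + s)`.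
  have hw : IsUnit (p' + s) := by
    rw [Matrix.SpecialLinearGroup.coe_mul, coe_psi_cell, coe_psi_cell] at h''
    have e : (q' : A) * p' * q + q' * (s * q) = q' * q * (p' + s) := by ring
    simp only [Matrix.mul_apply, Fin.sum_univ_two, Matrix.of_apply, Matrix.cons_val',
      Matrix.cons_val_zero, Matrix.cons_val_one, Matrix.cons_val_fin_one] at h''
    rw [e] at h''
    exact isUnit_of_mul_isUnit_right h''
  obtain ⟨w, hw⟩ := hw
  rw [← map_mul, cellSection_psi_cell, cellSection_psi_cell, cell_mul_cell _ _ _ _ _ _ _ hw,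
    cellSection_psi_cell]

theorem cellSection_inv {m : SL} (h : IsUnit (m 0 1)) :
    cellSection m⁻¹ = (cellSection m)⁻¹ := by
  obtain ⟨s, q, p, rfl⟩ := exists_cell h
  rw [← map_inv, cellSection_psi_cell, cell_inv, cellSection_psi_cell]

/-- Compatibility with lower triangular factors measures how the section changes when other matrices
are chosen above the same two vertices. -/
theorem cellSection_tri (s s' a : A) (q q' : Aˣ) :
    cellSection (psi A (tri s' q') * E a * (psi A (tri s q))⁻¹) =
      tri s' q' * eps a * (tri s q)⁻¹ := by
  have e : eps a = cell 0 1 a := by rw [cell, low_zero, hElt_one, one_mul, one_mul]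
  rw [← psi_eps, ← map_inv, ← map_mul, ← map_mul, e, tri_mul_cell, cell_mul_tri_inv,
    cellSection_psi_cell]

/-! ### Universality for `GE₂` from triviality of cocycles -/

theorem closure_eps : Subgroup.closure (Set.range (eps (A := A))) = ⊤ :=
  PresentedGroup.closure_range_of _

/-- Over the zero ring every `h(u)` is `h(1) = 1`, so `ε(0)` has trivial square and cube. This case
is separate because `Γ(A)` then has no edges. -/
theorem subsingleton_C [Subsingleton A] : Subsingleton (C A) := by
  have h1 : ∀ u : Aˣ, hElt u = 1 := fun u => by rw [Subsingleton.elim u 1, hElt_one]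
  have h2 : eps (0 : A) = 1 := by
    have h := hElt_eq (1 : Aˣ)
    rw [h1, Subsingleton.elim (-((1 : Aˣ) : A)) 0,
      Subsingleton.elim (-(((1 : Aˣ)⁻¹ : Aˣ) : A)) 0, eps_zero_sq, h1, one_mul] at h
    exact h.symm
  refine subsingleton_of_forall_eq 1 fun c => ?_
  have hc : c ∈ Subgroup.closure (Set.range (eps (A := A))) := by rw [closure_eps]; trivial
  have : Subgroup.closure (Set.range (eps (A := A))) ≤ ⊥ := by
    rw [Subgroup.closure_le]
    rintro _ ⟨a, rfl⟩
    rw [Subsingleton.elim a 0, h2]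
    exact Subgroup.one_mem _
  exact Subgroup.mem_bot.1 (this hc)

open Classical in
/-- The cocycle on `Y(A)` defined by a choice of matrices above the vertices. -/
noncomputable def cellCocycle (M : Vertex A → Matrix.SpecialLinearGroup (Fin 2) A)
    (x y : Vertex A) : C A :=
  if x = y then 1 else cellSection (M y * (M x)⁻¹)

theorem cellCocycle_mul {M : Vertex A → SL} (hM : ∀ x, vertexOf (M x) = x) {x y z : Vertex A}
    (hxy : Near x y) (hyz : Near y z) (hxz : Near x z) :
    cellCocycle M y z * cellCocycle M x y = cellCocycle M x z := by
  have hu : ∀ {x y}, Near x y → x ≠ y → IsUnit ((M y * (M x)⁻¹) 0 1) := fun {x y} h hne => by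
    have h' := h.resolve_left hne
    rw [← hM x, ← hM y] at h'
    exact isUnit_of_adj h'
  by_cases h1 : x = y
  · subst h1
    simp [cellCocycle]
  by_cases h2 : y = z
  · subst h2
    simp [cellCocycle]
  -- For `x = z` the product of matrices is the identity, to which `cellSection_mul` need not apply;
  -- `cellSection_inv` settles this case.
  by_cases h3 : x = z
  · subst h3
    rw [cellCocycle, cellCocycle, cellCocycle, if_neg h1, if_neg h2, if_pos rfl,
      ← mul_inv_cancel (cellSection (M x * (M y)⁻¹)), ← cellSection_inv (hu hyz h2), mul_inv_rev,
      inv_inv]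
  · have e : M z * (M y)⁻¹ * (M y * (M x)⁻¹) = M z * (M x)⁻¹ := by group
    rw [cellCocycle, cellCocycle, cellCocycle, if_neg h1, if_neg h2, if_neg h3,
      cellSection_mul (hu hxy h1) (hu hyz h2) (by rw [e]; exact hu hxz h3), e]

theorem isUniversalForGE2_of_isCoboundary [Nontrivial A]
    (h : ∀ k : Vertex A → Vertex A → C A,
      (∀ x y z, Near x y → Near y z → Near x z → k y z * k x y = k x z) →
        ∃ c : Vertex A → C A, ∀ x y, Near x y → c y = k x y * c x) : IsUniversalForGE2 A := by
  choose M hM using vertexOf_surjective (A := A)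
  obtain ⟨c, hc⟩ := h (cellCocycle M) fun x y z => cellCocycle_mul hM
  have hb : ∀ g : SL, ∃ s q, psi A (tri s q) * g = M (vertexOf g) := fun g =>
    exists_psi_tri_mul (hM _).symm
  choose s q hsq using hb
  -- The triangular factor corrects for the difference between `g` and the matrix chosen above its
  -- vertex, which makes `φ` equivariant under `C(A)`.
  let φ : SL → C A := fun g => (tri (s g) (q g))⁻¹ * c (vertexOf g)
  have hφ : ∀ a g, φ (E a * g) = eps a * φ g := by
    intro a g
    have hu : IsUnit ((E a * g * g⁻¹) 0 1) := by
      rw [mul_inv_cancel_right, coe_E]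
      simp
    have hadj := adj_of_isUnit hu
    have e : M (vertexOf (E a * g)) * (M (vertexOf g))⁻¹ =
        psi A (tri (s (E a * g)) (q (E a * g))) * E a * (psi A (tri (s g) (q g)))⁻¹ := by
      rw [← hsq g, ← hsq (E a * g)]
      group
    simp only [φ]
    rw [hc _ _ (Or.inr hadj), cellCocycle, if_neg hadj.1, e, cellSection_tri]
    group
  have key : ∀ d : C A, ∀ g, φ (psi A d * g) = d * φ g := by
    intro d
    have hd : d ∈ Subgroup.closure (Set.range (eps (A := A))) := by rw [closure_eps]; trivial
    induction hd using Subgroup.closure_induction with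
    | mem x hx =>
      obtain ⟨a, rfl⟩ := hx
      intro g
      rw [psi_eps, hφ]
    | one => simp
    | mul x y _ _ hx hy => intro g; rw [map_mul, mul_assoc, hx, hy, mul_assoc]
    | inv x _ hx =>
      intro g
      rw [eq_inv_mul_iff_mul_eq, ← hx, map_inv, mul_inv_cancel_left]
  rw [IsUniversalForGE2, injective_iff_map_eq_one]
  intro d hd
  have := key d 1
  rwa [hd, one_mul, eq_comm, mul_eq_right] at this

end GE2

theorem mainTheorem5 (A : Type*) [CommRing A] :
    GE2.IsUniversalForGE2 A ↔
      ∀ x : (GE2.Y A).Realization, SimplyConnectedSpace (pathComponent x) := by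
  rw [AbstractSimplicialComplex.forall_simplyConnectedSpace_iff]
  constructor
  · intro hA G _ k hk
    exact GE2.isCoboundary_iff.2
      (GE2.isCoboundary_of_isUniversalForGE2 (GE2.isCocycle_iff.1 hk) hA)
  · intro h
    rcases subsingleton_or_nontrivial A with hA | hA
    · have := GE2.subsingleton_C (A := A)
      exact Function.injective_of_subsingleton _
    · exact GE2.isUniversalForGE2_of_isCoboundary fun k hk =>
        GE2.isCoboundary_iff.1 (h _ k (GE2.isCocycle_iff.2 hk))
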